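/- **Setting.** Let $p\in[1,\infty)$, let $(\Omega,\mathcal F,P)$ be a probability space, and let $\rho:L^p\to(-\infty,+\infty]$ be a law-invariant coherent risk measure, that is: $\rho(X)\le\rho(Y)$ if $X\ge Y$ a.s.; $\rho(X+c)=\rho(X)-c$ for $c\in\mathbb R$; $\rho$ is convex; $\rho(\lambda X)=\lambda\rho(X)$ for $\lambda>0$; and $\rho(X)=\rho(Y)$ whenever $X$ and $Y$ are equal in distribution. Let $Z\ge 0$ be a random variable with finite moments of orders $p$ and $3$, and let $N_n$ be an $n$-dimensional standard normal vector independent of $Z$, both on $\Omega$. Let $A\in\mathbb R^{n\times n}$ be invertible, $\gamma\in\mathbb R^n$, $e=(1,\dots,1)^T$, $r>0$, and put $$\gamma_0=A^{-1}\gamma,\qquad Y=\gamma_0Z+\sqrt Z\,N_n,\qquad m=\gamma_0\,EZ,\qquad e_A=A^{-1}e .$$ Write $\mathrm{Skew}(X)=E(X-EX)^3/\mathrm{Var}(X)^{3/2}$ (with $0/0=0$), $m_3(Z)=E(Z-EZ)^3$, and $$S(\varphi)=\mathrm{Skew}\big(\|\gamma_0\|\varphi Z+\sqrt Z\,N\big),$$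 where $N$ is a standard normal variable independent of $Z$. Consider the multi-objective problem $$\text{(M)}\quad \min_x \rho(x^TY),\quad \max_x \mathrm{Skew}(x^TY)\quad\text{s.t. } x^Tm=r,\ x^Te_A=1,$$ whose solutions are the feasible $x$ that attain both optima simultaneously, and the quadratic problem $$\text{(Q)}\quad \min_x x^Tx\quad\text{s.t. } x^Tm=r,\ x^Te_A=1 .$$ **Theorem 2.5.** 1. For every $x\neq0$, $\mathrm{Skew}(x^TY)=S(\cos(x,\gamma_0))$, where $\cos(x,\gamma_0)$ is the cosine of the angle between $x$ and $\gamma_0$ (taken as $0$ if $\gamma_0=0$). 2. If $m_3(Z)\,EZ\ge 2\,\mathrm{Var}(Z)^2$, then $S$ is differentiable with $S'(\varphi)\ge0$ for all $\varphi\in[-1,1]$. 3. Suppose that $S$ is differentiable with $S'(\varphi)\ge0$ for all $\varphi\in[-1,1]$. Then every solution of (Q) is a solution of (M), and if $Z$ is not almost surely constant, (M) and (Q) have exactly the same solutions. In either case, if the determinant $(m^Tm)(e_A^Te_A)-(e_A^Tm)^2$ is nonzero, then the solution of (Q) is unique and equals $x=s\,m+t\,e_A$, where $$s=\begin{vmatrix}r&e_A^Tm\\1&e_A^Te_A\end{vmatrix}\Big/\begin{vmatrix}m^Tm&e_A^Tm\\m^Te_A&e_A^Te_A\end{vmatrix},\qquad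 t=\begin{vmatrix}m^Tm&r\\m^Te_A&1\end{vmatrix}\Big/\begin{vmatrix}m^Tm&e_A^Tm\\m^Te_A&e_A^Te_A\end{vmatrix}.$$ -/

import Mathlib

open MeasureTheory ProbabilityTheory

noncomputable section

namespace MeanRiskSkew

/-- Column vectors of real numbers with the Euclidean norm and inner product. -/
abbrev Vec (n : ℕ) : Type := EuclideanSpace ℝ (Fin n)

/-! ### Risk measures -/

/-- A convex risk measure on `L^p(P)`: a convex, monotone, cash-invariant functional with values
in `(-∞, +∞]`. It is written as a function of random variables, and only its values on random
variables with finite `p`-th moment matter. -/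
structure IsConvexRiskMeasure {Ω : Type*} [MeasurableSpace Ω] (P : Measure Ω) (p : ENNReal)
    (ρ : (Ω → ℝ) → EReal) : Prop where
  ne_bot : ∀ X, MemLp X p P → ρ X ≠ ⊥
  monotone : ∀ X Y, MemLp X p P → MemLp Y p P → (∀ᵐ ω ∂P, Y ω ≤ X ω) → ρ X ≤ ρ Y
  cash_invariant : ∀ X, MemLp X p P → ∀ c : ℝ, ρ (fun ω => X ω + c) = ρ X - (c : EReal)
  convex : ∀ X Y, MemLp X p P → MemLp Y p P → ∀ l : ℝ, 0 ≤ l → l ≤ 1 →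
    ρ (fun ω => l * X ω + (1 - l) * Y ω) ≤ (l : EReal) * ρ X + ((1 - l : ℝ) : EReal) * ρ Y

/-- A coherent risk measure on `L^p(P)`: a positively homogeneous convex risk measure. -/
structure IsCoherentRiskMeasure {Ω : Type*} [MeasurableSpace Ω] (P : Measure Ω) (p : ENNReal)
    (ρ : (Ω → ℝ) → EReal) : Prop extends IsConvexRiskMeasure P p ρ where
  pos_homogeneous : ∀ X, MemLp X p P → ∀ l : ℝ, 0 < l →
    ρ (fun ω => l * X ω) = (l : EReal) * ρ X

/-- `ρ` takes the same value on random variables of `L^p(P)` that are equal in distribution. -/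
def IsLawInvariant {Ω : Type*} [MeasurableSpace Ω] (P : Measure Ω) (p : ENNReal)
    (ρ : (Ω → ℝ) → EReal) : Prop :=
  ∀ X Y, MemLp X p P → MemLp Y p P → IdentDistrib X Y P P → ρ X = ρ Y

/-! ### Skewness -/

/-- The skewness `E (X - E X)^3 / StD(X)^3`. -/
def skewness {Ω : Type*} [MeasurableSpace Ω] (P : Measure Ω) (X : Ω → ℝ) : ℝ :=
  centralMoment X 3 P / (√(Var[X; P])) ^ 3

/-- The skewness of `g φ Z + √Z N`, as a function of `φ`, where `N` is a standard normal variable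
independent of `Z` (realized as the second coordinate on the product of the law of `Z` with the
standard normal law). For `g = ‖γ₀‖` and `φ = cos(x, γ₀)` this is the skewness of `xᵀY`. -/
def skewOfCos {Ω : Type*} [MeasurableSpace Ω] (P : Measure Ω) (Z : Ω → ℝ) (g : ℝ) (φ : ℝ) : ℝ :=
  skewness ((P.map Z).prod (gaussianReal 0 1)) (fun q : ℝ × ℝ => g * φ * q.1 + √q.1 * q.2)

/-- The derivative of the skewness in `φ` exists and is nonnegative on `[-1, 1]`. -/
def SkewDerivNonneg {Ω : Type*} [MeasurableSpace Ω] (P : Measure Ω) (Z : Ω → ℝ) (g : ℝ) : Prop :=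
  ∀ φ ∈ Set.Icc (-1 : ℝ) 1, ∃ d : ℝ, 0 ≤ d ∧ HasDerivAt (skewOfCos P Z g) d φ

/-! ### The model -/

/-- `γ₀ = A⁻¹ γ`, the coefficients of `γ` in the basis of columns of `A`. -/
def gamma0 {n : ℕ} (A : Matrix (Fin n) (Fin n) ℝ) (γ : Vec n) : Vec n :=
  WithLp.toLp 2 (Matrix.mulVec A⁻¹ (fun i => γ i))

/-- `e_A = A⁻¹ e`, where `e` is the vector of ones. -/
def eA {n : ℕ} (A : Matrix (Fin n) (Fin n) ℝ) : Vec n :=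
  WithLp.toLp 2 (Matrix.mulVec A⁻¹ (fun _ => 1))

/-- `m = γ₀ E Z`. -/
def meanVec {Ω : Type*} [MeasurableSpace Ω] {n : ℕ} (P : Measure Ω) (Z : Ω → ℝ)
    (A : Matrix (Fin n) (Fin n) ℝ) (γ : Vec n) : Vec n :=
  (∫ ω, Z ω ∂P) • gamma0 A γ

/-- The random variable `xᵀY`, where `Y = γ₀ Z + √Z N`. -/
def portfolio {Ω : Type*} {n : ℕ} (Z : Ω → ℝ) (N : Ω → Vec n) (A : Matrix (Fin n) (Fin n) ℝ)
    (γ : Vec n) (x : Vec n) : Ω → ℝ :=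
  fun ω => inner ℝ x (Z ω • gamma0 A γ + √(Z ω) • N ω)

/-! ### The optimization problems -/

/-- The constraint set `xᵀm = r`, `xᵀe_A = 1`. -/
def feasible {n : ℕ} (m e : Vec n) (r : ℝ) : Set (Vec n) :=
  {x | inner ℝ x m = r ∧ inner ℝ x e = 1}

/-- The solutions of: minimize `risk` and maximize `skew` simultaneously over `D`. -/
def riskSkewSolutions {n : ℕ} (risk : Vec n → EReal) (skew : Vec n → ℝ) (D : Set (Vec n)) :
    Set (Vec n) :=
  {x | x ∈ D ∧ (∀ y ∈ D, risk x ≤ risk y) ∧ (∀ y ∈ D, skew y ≤ skew x)}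

/-- The solutions of: minimize `xᵀx` over `D`. -/
def quadraticSolutions {n : ℕ} (D : Set (Vec n)) : Set (Vec n) :=
  {x | x ∈ D ∧ ∀ y ∈ D, inner ℝ x x ≤ inner ℝ y y}

/-- The determinant of the Gram matrix of `m` and `e`. -/
def gramDet {n : ℕ} (m e : Vec n) : ℝ :=
  Matrix.det !![inner ℝ m m, inner ℝ e m; inner ℝ m e, inner ℝ e e]

/-- The coefficient of `m` in the explicit solution. -/
def coeffS {n : ℕ} (m e : Vec n) (r : ℝ) : ℝ :=
  Matrix.det !![r, inner ℝ e m; 1, inner ℝ e e] / gramDet m e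

/-- The coefficient of `e` in the explicit solution. -/
def coeffT {n : ℕ} (m e : Vec n) (r : ℝ) : ℝ :=
  Matrix.det !![inner ℝ m m, r; inner ℝ m e, 1] / gramDet m e

end MeanRiskSkew

end

open MeanRiskSkew

/-!
All portfolios `xᵀY = (xᵀγ₀) Z + √Z xᵀN` are, in law, of the form `c Z + ‖x‖ √Z N₁` with a standard
normal `N₁` independent of `Z` (`identDistrib_mixture`). Dividing by `‖x‖`, which does not change
the skewness, shows that the skewness depends only on the cosine of the angle between `x` and `γ₀`.

The moments of `a Z + √Z N₁` give its skewness in closed form,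
`(a³ m₃ + 3 a V) / (a² V + μ)^(3/2)` with `a = ‖γ₀‖ φ`, `V = Var Z`, `μ = E Z`, whose derivative in `a`
is `3 (a² (m₃ μ - 2 V²) + V μ) / (a² V + μ)^(5/2)` (`hasDerivAt_skewOfCos`). The sufficient condition
is read off from it.

On the feasible set `xᵀγ₀ = r / μ > 0` is constant. Hence a shorter `x` has a larger cosine and,
`S` being nondecreasing, a larger skewness. It also has a smaller risk: `c Z + a √Z N₁` with
`0 ≤ a ≤ b` is a convex combination of `c Z + b √Z N₁` and `c Z - b √Z N₁`, which have the same law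
and therefore the same risk (`risk_mixture_le`). So points of minimal norm are optimal for both
objectives. If `V ≠ 0`, the formula for the derivative makes `S` strictly increasing on `[0, 1]`
(`SkewDerivNonneg.strictMonoOn`), and only points of minimal norm maximize the skewness. The
explicit solution is the projection of the origin to the feasible set.
-/

namespace MeanRiskSkew


/-! ### Moments of a normal mean-variance mixture -/

lemma integral_cube_gaussianReal : ∫ u : ℝ, u ^ 3 ∂(gaussianReal 0 1) = 0 := by
  have h : ∫ u : ℝ, u ^ 3 ∂((gaussianReal 0 1).map (fun x => -x)) =
      ∫ u : ℝ, (-u) ^ 3 ∂(gaussianReal 0 1) :=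
    integral_map (by fun_prop) (by fun_prop)
  rw [gaussianReal_map_neg, neg_zero] at h
  simp only [Odd.neg_pow (by decide : Odd 3), integral_neg] at h
  linarith

lemma integral_sq_gaussianReal : ∫ u : ℝ, u ^ 2 ∂(gaussianReal 0 1) = 1 := by
  have h := variance_fun_id_gaussianReal (μ := 0) (v := 1)
  rw [variance_eq_integral (by fun_prop)] at h
  simpa using h

lemma integrable_pow_gaussianReal (k : ℕ) :
    Integrable (fun u : ℝ => u ^ k) (gaussianReal 0 1) := by
  have h : MemLp (id : ℝ → ℝ) k (gaussianReal 0 1) := memLp_id_gaussianReal' _ (by simp)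
  refine (integrable_norm_iff (by fun_prop)).1 ?_
  simpa using h.integrable_norm_pow'

lemma _root_.MeasureTheory.MemLp.integrable_mul_three {α : Type*} [MeasurableSpace α]
    {μ : Measure α} {f g h : α → ℝ} (hf : MemLp f 3 μ) (hg : MemLp g 3 μ) (hh : MemLp h 3 μ) :
    Integrable (fun x => f x * g x * h x) μ := by
  have key : ∀ {f : α → ℝ}, MemLp f 3 μ → Integrable (fun x => ‖f x‖ ^ 3) μ := fun hf => by
    have := MemLp.integrable_norm_pow (p := 3) (by exact_mod_cast hf) (by norm_num)
    exact this
  refine ((key hf).add ((key hg).add (key hh))).mono' ?_ (.of_forall fun x => ?_)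
  · exact (hf.1.mul hg.1).mul hh.1
  · simp only [norm_mul, Pi.add_apply]
    set a := ‖f x‖
    set b := ‖g x‖
    set c := ‖h x‖
    have ha : 0 ≤ a := norm_nonneg _
    have hb : 0 ≤ b := norm_nonneg _
    have hc : 0 ≤ c := norm_nonneg _
    have hM : 0 ≤ a * b * c := by positivity
    -- `a³ + b³ + c³ - 3abc = (a + b + c) ((a - b)² + (b - c)² + (c - a)²) / 2`
    nlinarith [mul_nonneg (add_nonneg (add_nonneg ha hb) hc)
      (add_nonneg (add_nonneg (sq_nonneg (a - b)) (sq_nonneg (b - c))) (sq_nonneg (c - a)))]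

lemma _root_.MeasureTheory.MemLp.sqrt {α : Type*} [MeasurableSpace α] {μ : Measure α}
    [IsFiniteMeasure μ] {p : ENNReal} {f : α → ℝ} (hf : MemLp f p μ) :
    MemLp (fun x => √(f x)) p μ := by
  have hc : MemLp (fun _ : α => (1 : ℝ)) p μ := memLp_const 1
  have h1 : MemLp (fun x => 1 + ‖f x‖) p μ := hc.add hf.norm
  refine h1.mono (hf.1.aemeasurable.sqrt.aestronglyMeasurable) (.of_forall fun x => ?_)
  rw [Real.norm_of_nonneg (Real.sqrt_nonneg _), Real.norm_of_nonneg (by positivity)]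
  refine Real.sqrt_le_iff.2 ⟨by positivity, ?_⟩
  nlinarith [le_abs_self (f x), Real.norm_eq_abs (f x), norm_nonneg (f x)]

section Moments

variable {ζ : Measure ℝ} [IsProbabilityMeasure ζ]

lemma integral_mixture (h3 : MemLp id 3 ζ) (a : ℝ) :
    ∫ q, (a * q.1 + √q.1 * q.2) ∂(ζ.prod (gaussianReal 0 1)) = a * ∫ z, z ∂ζ := by
  have hz : Integrable (fun z : ℝ => z) ζ := h3.integrable (by norm_num)
  have hs : Integrable (fun z : ℝ => √z) ζ := (h3.sqrt).integrable (by norm_num)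
  have hu : Integrable (fun u : ℝ => u) (gaussianReal 0 1) := by
    simpa using integrable_pow_gaussianReal 1
  rw [integral_add, integral_prod_mul (fun z : ℝ => √z) (fun u : ℝ => u), integral_const_mul,
    integral_fun_fst (fun z : ℝ => z)]
  · simp
  · exact (hz.comp_fst _).const_mul a
  · exact hs.mul_prod hu

lemma variance_mixture (h0 : ∀ᵐ z ∂ζ, 0 ≤ z) (h3 : MemLp id 3 ζ) (a : ℝ) :
    Var[fun q : ℝ × ℝ => a * q.1 + √q.1 * q.2; ζ.prod (gaussianReal 0 1)] =
      a ^ 2 * Var[id; ζ] + ∫ z, z ∂ζ := by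
  set c := ∫ z, z ∂ζ with hc
  have hd : MemLp (fun z : ℝ => z - c) 3 ζ := h3.sub (memLp_const c)
  have h1 : MemLp (fun _ : ℝ => (1 : ℝ)) 3 ζ := memLp_const 1
  have hs : MemLp (fun z : ℝ => √z) 3 ζ := h3.sqrt
  have hf : ∀ᵐ q ∂(ζ.prod (gaussianReal 0 1)), (a * q.1 + √q.1 * q.2 - a * c) ^ 2 =
      a ^ 2 * ((q.1 - c) ^ 2 * q.2 ^ 0) + (2 * a * (((q.1 - c) * √q.1) * q.2 ^ 1) +
        q.1 * q.2 ^ 2) := by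
    filter_upwards [Measure.quasiMeasurePreserving_fst.ae h0] with q hq
    linear_combination q.2 ^ 2 * Real.sq_sqrt hq
  rw [variance_eq_integral (by fun_prop), integral_mixture h3, ← hc, integral_congr_ae hf]
  have i1 : Integrable (fun q : ℝ × ℝ => (q.1 - c) ^ 2 * q.2 ^ 0) (ζ.prod (gaussianReal 0 1)) :=
    Integrable.mul_prod (f := fun z : ℝ => (z - c) ^ 2)
      (by simpa [sq] using hd.integrable_mul_three hd h1) (integrable_pow_gaussianReal 0)
  have i2 : Integrable (fun q : ℝ × ℝ => ((q.1 - c) * √q.1) * q.2 ^ 1)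
      (ζ.prod (gaussianReal 0 1)) :=
    Integrable.mul_prod (f := fun z : ℝ => (z - c) * √z)
      (by simpa using hd.integrable_mul_three hs h1) (integrable_pow_gaussianReal 1)
  have i3 : Integrable (fun q : ℝ × ℝ => q.1 * q.2 ^ 2) (ζ.prod (gaussianReal 0 1)) :=
    Integrable.mul_prod (f := fun z : ℝ => z) (h3.integrable (by norm_num))
      (integrable_pow_gaussianReal 2)
  have j2 : Integrable (fun q : ℝ × ℝ => 2 * a * (((q.1 - c) * √q.1) * q.2 ^ 1) + q.1 * q.2 ^ 2)
      (ζ.prod (gaussianReal 0 1)) := (i2.const_mul _).add i3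
  rw [integral_add (i1.const_mul _) j2, integral_add (i2.const_mul _) i3, integral_const_mul, integral_const_mul,
    integral_prod_mul (fun z : ℝ => (z - c) ^ 2) (fun u : ℝ => u ^ 0),
    integral_prod_mul (fun z : ℝ => (z - c) * √z) (fun u : ℝ => u ^ 1),
    integral_prod_mul (fun z : ℝ => z) (fun u : ℝ => u ^ 2), integral_sq_gaussianReal,
    variance_eq_integral (by fun_prop)]
  simp [hc]

lemma centralMoment_three_mixture (h0 : ∀ᵐ z ∂ζ, 0 ≤ z) (h3 : MemLp id 3 ζ) (a : ℝ) :
    centralMoment (fun q : ℝ × ℝ => a * q.1 + √q.1 * q.2) 3 (ζ.prod (gaussianReal 0 1)) =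
      a ^ 3 * centralMoment id 3 ζ + 3 * a * Var[id; ζ] := by
  set c := ∫ z, z ∂ζ with hc
  have hd : MemLp (fun z : ℝ => z - c) 3 ζ := h3.sub (memLp_const c)
  have h1 : MemLp (fun _ : ℝ => (1 : ℝ)) 3 ζ := memLp_const 1
  have hs : MemLp (fun z : ℝ => √z) 3 ζ := h3.sqrt
  have hz : MemLp (fun z : ℝ => z) 3 ζ := h3
  have hf : ∀ᵐ q ∂(ζ.prod (gaussianReal 0 1)), (a * q.1 + √q.1 * q.2 - a * c) ^ 3 =
      a ^ 3 * ((q.1 - c) ^ 3 * q.2 ^ 0) + (3 * a ^ 2 * (((q.1 - c) ^ 2 * √q.1) * q.2 ^ 1) +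
        (3 * a * (((q.1 - c) * q.1) * q.2 ^ 2) + (q.1 * √q.1) * q.2 ^ 3)) := by
    filter_upwards [Measure.quasiMeasurePreserving_fst.ae h0] with q hq
    linear_combination (3 * a * (q.1 - c) * q.2 ^ 2 + √q.1 * q.2 ^ 3) * Real.sq_sqrt hq
  have i1 : Integrable (fun q : ℝ × ℝ => (q.1 - c) ^ 3 * q.2 ^ 0) (ζ.prod (gaussianReal 0 1)) :=
    Integrable.mul_prod (f := fun z : ℝ => (z - c) ^ 3)
      (by simpa [pow_succ] using hd.integrable_mul_three hd hd) (integrable_pow_gaussianReal 0)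
  have i2 : Integrable (fun q : ℝ × ℝ => ((q.1 - c) ^ 2 * √q.1) * q.2 ^ 1)
      (ζ.prod (gaussianReal 0 1)) :=
    Integrable.mul_prod (f := fun z : ℝ => (z - c) ^ 2 * √z)
      (by simpa [sq] using hd.integrable_mul_three hd hs) (integrable_pow_gaussianReal 1)
  have i3 : Integrable (fun q : ℝ × ℝ => ((q.1 - c) * q.1) * q.2 ^ 2)
      (ζ.prod (gaussianReal 0 1)) :=
    Integrable.mul_prod (f := fun z : ℝ => (z - c) * z)
      (by simpa using hd.integrable_mul_three hz h1) (integrable_pow_gaussianReal 2)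
  have i4 : Integrable (fun q : ℝ × ℝ => (q.1 * √q.1) * q.2 ^ 3)
      (ζ.prod (gaussianReal 0 1)) :=
    Integrable.mul_prod (f := fun z : ℝ => z * √z)
      (by simpa using hz.integrable_mul_three hs h1) (integrable_pow_gaussianReal 3)
  have j3 : Integrable (fun q : ℝ × ℝ => 3 * a * (((q.1 - c) * q.1) * q.2 ^ 2) +
      (q.1 * √q.1) * q.2 ^ 3) (ζ.prod (gaussianReal 0 1)) := (i3.const_mul _).add i4
  have j2 : Integrable (fun q : ℝ × ℝ => 3 * a ^ 2 * (((q.1 - c) ^ 2 * √q.1) * q.2 ^ 1) +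
      (3 * a * (((q.1 - c) * q.1) * q.2 ^ 2) + (q.1 * √q.1) * q.2 ^ 3))
      (ζ.prod (gaussianReal 0 1)) := (i2.const_mul _).add j3
  -- `E (Z - E Z) Z` is the variance
  have hV : ∫ z, (z - c) * z ∂ζ = Var[id; ζ] := by
    have e : ∀ z : ℝ, (z - c) * z = (z - c) ^ 2 + c * (z - c) := fun z => by ring
    simp_rw [e]
    rw [integral_add (by simpa [sq] using hd.integrable_mul_three hd h1)
      ((hd.integrable (by norm_num)).const_mul c), integral_const_mul,
      integral_sub (hz.integrable (by norm_num)) (integrable_const c),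
      variance_eq_integral (by fun_prop)]
    simp [hc]
  simp only [centralMoment, Pi.pow_apply, Pi.sub_apply, id_eq]
  rw [integral_mixture h3, ← hc, integral_congr_ae hf,
    integral_add (i1.const_mul _) j2, integral_add (i2.const_mul _) j3,
    integral_add (i3.const_mul _) i4, integral_const_mul, integral_const_mul, integral_const_mul,
    integral_prod_mul (fun z : ℝ => (z - c) ^ 3) (fun u : ℝ => u ^ 0),
    integral_prod_mul (fun z : ℝ => (z - c) ^ 2 * √z) (fun u : ℝ => u ^ 1),
    integral_prod_mul (fun z : ℝ => (z - c) * z) (fun u : ℝ => u ^ 2),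
    integral_prod_mul (fun z : ℝ => z * √z) (fun u : ℝ => u ^ 3), integral_sq_gaussianReal,
    integral_cube_gaussianReal, hV]
  simp

end Moments

section Skew

variable {Ω : Type*} [MeasurableSpace Ω] {P : Measure Ω} [IsProbabilityMeasure P] {Z : Ω → ℝ}

/-- The skewness in closed form, from which the derivative is computed. -/
lemma skewOfCos_eq (hZ0 : ∀ᵐ ω ∂P, 0 ≤ Z ω) (hZ3 : MemLp Z 3 P) (g φ : ℝ) :
    skewOfCos P Z g φ = ((g * φ) ^ 3 * centralMoment Z 3 P + 3 * (g * φ) * Var[Z; P]) /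
      √((g * φ) ^ 2 * Var[Z; P] + ∫ ω, Z ω ∂P) ^ 3 := by
  have hZ : AEMeasurable Z P := hZ3.1.aemeasurable
  have : IsProbabilityMeasure (P.map Z) := Measure.isProbabilityMeasure_map hZ
  have h0 : ∀ᵐ z ∂(P.map Z), 0 ≤ z := (ae_map_iff hZ measurableSet_Ici).2 hZ0
  have h3 : MemLp id 3 (P.map Z) := (memLp_map_measure_iff (by fun_prop) hZ).2 hZ3
  have hμ : ∫ z, z ∂(P.map Z) = ∫ ω, Z ω ∂P := integral_map hZ (by fun_prop)
  have hm : centralMoment id 3 (P.map Z) = centralMoment Z 3 P := by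
    simp only [centralMoment, Pi.pow_apply, Pi.sub_apply, id_eq, hμ]
    exact integral_map hZ (by fun_prop)
  rw [skewOfCos, skewness, variance_mixture h0 h3, centralMoment_three_mixture h0 h3, hμ, hm,
    variance_id_map hZ]

lemma hasDerivAt_skewOfCos (hZ0 : ∀ᵐ ω ∂P, 0 ≤ Z ω) (hZ3 : MemLp Z 3 P)
    (hμ : 0 < ∫ ω, Z ω ∂P) (g φ : ℝ) :
    HasDerivAt (skewOfCos P Z g)
      (3 * g * ((g * φ) ^ 2 * (centralMoment Z 3 P * (∫ ω, Z ω ∂P) - 2 * Var[Z; P] ^ 2) +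
        Var[Z; P] * ∫ ω, Z ω ∂P) / √((g * φ) ^ 2 * Var[Z; P] + ∫ ω, Z ω ∂P) ^ 5) φ := by
  rw [funext (skewOfCos_eq hZ0 hZ3 g)]
  have hV : 0 ≤ Var[Z; P] := variance_nonneg _ _
  set V := Var[Z; P]
  set c := ∫ ω, Z ω ∂P
  set k := centralMoment Z 3 P
  have hD : 0 < (g * φ) ^ 2 * V + c := by positivity
  have hlin : HasDerivAt (fun φ : ℝ => g * φ) g φ := by
    simpa using (hasDerivAt_id φ).const_mul g
  have hnum := ((hlin.fun_pow 3).mul_const k).add ((hlin.const_mul 3).mul_const V)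
  have hden := ((((hlin.fun_pow 2).mul_const V).add_const c).sqrt hD.ne').fun_pow 3
  have hs : 0 < √((g * φ) ^ 2 * V + c) := Real.sqrt_pos.2 hD
  have hsq := Real.sq_sqrt hD.le
  refine (hnum.fun_div hden (by positivity)).congr_deriv ?_
  set s := √((g * φ) ^ 2 * V + c)
  field_simp
  norm_num
  rw [show s ^ 4 = s ^ 2 * s ^ 2 by ring, hsq]
  ring

end Skew


/-! ### The sign of the derivative of the skewness -/

section SkewDeriv

variable {Ω : Type*} [MeasurableSpace Ω] {P : Measure Ω} {Z : Ω → ℝ}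

lemma skewDerivNonneg_of_le [IsProbabilityMeasure P] (hZ0 : ∀ᵐ ω ∂P, 0 ≤ Z ω) (hZ3 : MemLp Z 3 P) {g : ℝ} (hg : 0 ≤ g)
    (h : 2 * Var[Z; P] ^ 2 ≤ centralMoment Z 3 P * (∫ ω, Z ω ∂P)) :
    SkewDerivNonneg P Z g := by
  intro φ _
  have hμ0 : 0 ≤ ∫ ω, Z ω ∂P := integral_nonneg_of_ae hZ0
  rcases hμ0.eq_or_lt with hμ | hμ
  · -- if `E Z = 0` then `Z = 0` a.s. and the skewness is `0 / 0 = 0` for every `φ`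
    have hZ : Z =ᵐ[P] 0 :=
      (integral_eq_zero_iff_of_nonneg_ae hZ0 (hZ3.integrable (by norm_num))).1 hμ.symm
    have hV : Var[Z; P] = 0 := by rw [variance_congr hZ, variance_zero]
    have hS : skewOfCos P Z g = fun _ => 0 := by
      funext ψ
      simp [skewOfCos_eq hZ0 hZ3, hV, ← hμ]
    exact ⟨0, le_rfl, hS ▸ hasDerivAt_const φ 0⟩
  · refine ⟨_, ?_, hasDerivAt_skewOfCos hZ0 hZ3 hμ g φ⟩
    have h1 := sub_nonneg.2 h
    have h2 := variance_nonneg Z P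
    positivity

lemma SkewDerivNonneg.monotoneOn {g : ℝ} (h : SkewDerivNonneg P Z g) :
    MonotoneOn (skewOfCos P Z g) (Set.Icc (-1) 1) := by
  refine monotoneOn_of_deriv_nonneg (convex_Icc _ _) (fun φ hφ => ?_) (fun φ hφ => ?_)
    fun φ hφ => ?_
  · obtain ⟨d, -, hd⟩ := h φ hφ
    exact hd.continuousAt.continuousWithinAt
  · obtain ⟨d, -, hd⟩ := h φ (interior_subset hφ)
    exact hd.differentiableAt.differentiableWithinAt
  · obtain ⟨d, h0, hd⟩ := h φ (interior_subset hφ)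
    rwa [hd.deriv]

/-- The sign of `S'(φ)` is that of `(g φ)² K + Var Z · E Z` with a constant `K`. This expression is
affine in `φ²`, positive at `φ = 0` and nonnegative at `φ = 1`, hence positive in between. -/
lemma SkewDerivNonneg.strictMonoOn [IsProbabilityMeasure P] (hZ0 : ∀ᵐ ω ∂P, 0 ≤ Z ω) (hZ3 : MemLp Z 3 P)
    (hμ : 0 < ∫ ω, Z ω ∂P) (hV : Var[Z; P] ≠ 0) {g : ℝ} (hg : 0 < g)
    (h : SkewDerivNonneg P Z g) :
    StrictMonoOn (skewOfCos P Z g) (Set.Icc 0 1) := by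
  have hder := hasDerivAt_skewOfCos hZ0 hZ3 hμ g
  have hV' : 0 < Var[Z; P] := lt_of_le_of_ne (variance_nonneg _ _) hV.symm
  obtain ⟨d, hd0, hd⟩ := h 1 (by norm_num)
  rw [hd.unique (hder 1)] at hd0
  refine strictMonoOn_of_deriv_pos (convex_Icc _ _)
    (fun φ _ => (hder φ).continuousAt.continuousWithinAt) fun φ hφ => ?_
  rw [interior_Icc] at hφ
  rw [(hder φ).deriv]
  generalize Var[Z; P] = V at *
  generalize ∫ ω, Z ω ∂P = c at *
  generalize centralMoment Z 3 P * c - 2 * V ^ 2 = K at *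
  have hVc : 0 < V * c := mul_pos hV' hμ
  have hs : ∀ ψ : ℝ, 0 < √((g * ψ) ^ 2 * V + c) ^ 5 := fun ψ => by positivity
  have h1 : 0 ≤ g ^ 2 * K + V * c := by
    have := (le_div_iff₀ (hs 1)).1 hd0
    rw [zero_mul, mul_one] at this
    exact nonneg_of_mul_nonneg_right this (by positivity)
  have hφ2 : 0 < 1 - φ ^ 2 := by nlinarith [hφ.1, hφ.2]
  have h2 : 0 < (g * φ) ^ 2 * K + V * c := by
    have e : (g * φ) ^ 2 * K + V * c = φ ^ 2 * (g ^ 2 * K + V * c) + (1 - φ ^ 2) * (V * c) := by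
      ring
    rw [e]
    positivity
  have := hs φ
  positivity

end SkewDeriv

/-! ### The law of a portfolio -/

section Law

variable {Ω : Type*} {n : ℕ} {Z : Ω → ℝ} {N : Ω → Vec n}

/-- The random variable `c Z + √Z vᵀN`. A portfolio has this form, with `c = xᵀγ₀` and `v = x`;
the coefficient of `Z` and the vector multiplying `N` are decoupled so that `v` can be varied while
`c` is kept. -/
noncomputable def mixture (Z : Ω → ℝ) (N : Ω → Vec n) (c : ℝ) (v : Vec n) : Ω → ℝ :=
  fun ω => c * Z ω + √(Z ω) * inner ℝ v (N ω)

lemma portfolio_eq_mixture (A : Matrix (Fin n) (Fin n) ℝ) (γ x : Vec n) :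
    portfolio Z N A γ x = mixture Z N (inner ℝ x (gamma0 A γ)) x := by
  funext ω
  simp [portfolio, mixture, inner_add_right, inner_smul_right, mul_comm]

variable [MeasurableSpace Ω] {P : Measure Ω}

lemma hasLaw_inner_stdGaussian (hN : HasLaw N (stdGaussian (Vec n)) P) (v : Vec n) :
    HasLaw (fun ω => inner ℝ v (N ω)) ((gaussianReal 0 1).map (‖v‖ * ·)) P := by
  have hm := hN.aemeasurable
  refine ⟨by fun_prop, ?_⟩
  have h : P.map (fun ω => inner ℝ v (N ω)) =
      (stdGaussian (Vec n)).map (innerSL ℝ v) := by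
    rw [← hN.map_eq, AEMeasurable.map_map_of_aemeasurable (by fun_prop) hm]
    rfl
  rw [h, IsGaussian.map_eq_gaussianReal, gaussianReal_map_const_mul,
    integral_strongDual_stdGaussian, variance_dual_stdGaussian, innerSL_apply_norm]
  congr 1
  · simp
  · ext
    simp

/-- The law of `c Z + √Z vᵀN` depends on `v` only through `‖v‖`. -/
lemma identDistrib_mixture [IsProbabilityMeasure P] (hZ : AEMeasurable Z P) (hN : HasLaw N (stdGaussian (Vec n)) P)
    (hZN : IndepFun Z N P) (c : ℝ) (v : Vec n) :
    IdentDistrib (mixture Z N c v) (fun q : ℝ × ℝ => c * q.1 + √q.1 * (‖v‖ * q.2)) P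
      ((P.map Z).prod (gaussianReal 0 1)) := by
  have : IsProbabilityMeasure (P.map Z) := Measure.isProbabilityMeasure_map hZ
  have hI : IndepFun Z (fun ω => inner ℝ v (N ω)) P :=
    hZN.comp measurable_id (ψ := fun w : Vec n => inner ℝ v w) (by fun_prop)
  have hv := hasLaw_inner_stdGaussian hN v
  have hpair : IdentDistrib (fun ω => (Z ω, inner ℝ v (N ω)))
      (Prod.map id (‖v‖ * ·) : ℝ × ℝ → ℝ × ℝ) P ((P.map Z).prod (gaussianReal 0 1)) := by
    refine ⟨hZ.prodMk hv.aemeasurable, by fun_prop, ?_⟩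
    rw [hI.map_prod_eq_prod_map_map hZ hv.aemeasurable, hv.map_eq,
      ← Measure.map_prod_map _ _ measurable_id (by fun_prop), Measure.map_id]
  exact hpair.comp (u := fun q : ℝ × ℝ => c * q.1 + √q.1 * q.2) (by fun_prop)

lemma identDistrib_mixture_of_norm_eq [IsProbabilityMeasure P] (hZ : AEMeasurable Z P)
    (hN : HasLaw N (stdGaussian (Vec n)) P) (hZN : IndepFun Z N P) (c : ℝ) {v w : Vec n}
    (h : ‖v‖ = ‖w‖) : IdentDistrib (mixture Z N c v) (mixture Z N c w) P P := by
  have h1 := identDistrib_mixture hZ hN hZN c v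
  rw [h] at h1
  exact h1.trans (identDistrib_mixture hZ hN hZN c w).symm

lemma _root_.MeasureTheory.MemLp.mul_prod {α β : Type*} [MeasurableSpace α] [MeasurableSpace β]
    {μ : Measure α} {ν : Measure β} [SFinite μ] [SFinite ν] {p : ENNReal} {f : α → ℝ} {g : β → ℝ}
    (hf : MemLp f p μ) (hp0 : p ≠ 0) (hp : p ≠ ⊤) (hg : MemLp g p ν) :
    MemLp (fun q : α × β => f q.1 * g q.2) p (μ.prod ν) := by
  have h := (hf.integrable_norm_rpow hp0 hp).mul_prod (hg.integrable_norm_rpow hp0 hp)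
  refine (integrable_norm_rpow_iff (hf.1.comp_fst.mul hg.1.comp_snd) hp0 hp).1 ?_
  refine h.congr (.of_forall fun q => ?_)
  simp only [Pi.mul_apply, norm_mul]
  rw [Real.mul_rpow (norm_nonneg _) (norm_nonneg _)]

lemma memLp_mixture [IsProbabilityMeasure P] {p : ENNReal} (hp : 1 ≤ p) (hp' : p ≠ ⊤) (hZp : MemLp Z p P)
    (hN : HasLaw N (stdGaussian (Vec n)) P) (hZN : IndepFun Z N P) (c : ℝ) (v : Vec n) :
    MemLp (mixture Z N c v) p P := by
  have hZ : AEMeasurable Z P := hZp.1.aemeasurable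
  have : IsProbabilityMeasure (P.map Z) := Measure.isProbabilityMeasure_map hZ
  refine (identDistrib_mixture hZ hN hZN c v).memLp_iff.2 ?_
  have hid : MemLp id p (P.map Z) := (memLp_map_measure_iff (by fun_prop) hZ).2 hZp
  have hG : MemLp id p (gaussianReal 0 1) := memLp_id_gaussianReal' p hp'
  exact ((hid.comp_fst _).const_mul c).add (hid.sqrt.mul_prod (zero_lt_one.trans_le hp).ne' hp' (hG.const_mul ‖v‖))

lemma _root_.ProbabilityTheory.IdentDistrib.skewness_eq {Ω' : Type*} [MeasurableSpace Ω']
    {P' : Measure Ω'} {X : Ω → ℝ} {Y : Ω' → ℝ} (h : IdentDistrib X Y P P') :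
    skewness P X = skewness P' Y := by
  have hc : centralMoment X 3 P = centralMoment Y 3 P' := by
    simp only [centralMoment]
    rw [h.integral_eq]
    exact (h.comp (u := fun t : ℝ => (t - ∫ ω, Y ω ∂P') ^ 3) (by fun_prop)).integral_eq
  rw [skewness, skewness, hc, h.variance_eq]

lemma skewness_const_mul (P : Measure Ω) (X : Ω → ℝ) {a : ℝ} (ha : 0 < a) :
    skewness P (fun ω => a * X ω) = skewness P X := by
  have hc : centralMoment (fun ω => a * X ω) 3 P = a ^ 3 * centralMoment X 3 P := by
    simp only [centralMoment, Pi.pow_apply, Pi.sub_apply]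
    rw [integral_const_mul, ← integral_const_mul (a ^ 3)]
    refine integral_congr_ae (.of_forall fun ω => ?_)
    ring
  rw [skewness, skewness, hc, variance_const_mul, Real.sqrt_mul (by positivity),
    Real.sqrt_sq ha.le, mul_pow, mul_div_mul_left _ _ (by positivity)]

lemma skewness_portfolio [IsProbabilityMeasure P] (hZ : AEMeasurable Z P) (hN : HasLaw N (stdGaussian (Vec n)) P)
    (hZN : IndepFun Z N P) (A : Matrix (Fin n) (Fin n) ℝ) (γ : Vec n) {x : Vec n} (hx : x ≠ 0) :
    skewness P (portfolio Z N A γ x) =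
      skewOfCos P Z ‖gamma0 A γ‖ (Real.cos (InnerProductGeometry.angle x (gamma0 A γ))) := by
  rw [portfolio_eq_mixture, (identDistrib_mixture hZ hN hZN _ x).skewness_eq, skewOfCos,
    ← skewness_const_mul _ (fun q : ℝ × ℝ => _ * q.1 + √q.1 * q.2) (norm_pos_iff.2 hx)]
  congr 1
  funext q
  rw [← InnerProductGeometry.cos_angle_mul_norm_mul_norm]
  ring

end Law

/-! ### Monotonicity of the risk -/

section Risk

variable {Ω : Type*} [MeasurableSpace Ω] {P : Measure Ω} {n : ℕ}
  {Z : Ω → ℝ} {N : Ω → Vec n} {p : ENNReal} {ρ : (Ω → ℝ) → EReal}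

lemma IsConvexRiskMeasure.convexComb_le_of_eq (hρ : IsConvexRiskMeasure P p ρ) {X Y : Ω → ℝ}
    (hX : MemLp X p P) (hY : MemLp Y p P) (h : ρ X = ρ Y) {l : ℝ} (hl0 : 0 ≤ l) (hl1 : l ≤ 1) :
    ρ (fun ω => l * X ω + (1 - l) * Y ω) ≤ ρ X := by
  have hc := hρ.convex X Y hX hY l hl0 hl1
  have hb := hρ.ne_bot X hX
  rw [← h] at hc
  generalize ρ X = t at *
  induction t with
  | bot => exact absurd rfl hb
  | top => exact le_top
  | coe t =>
    refine hc.trans (le_of_eq ?_)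
    norm_cast
    ring

/-- At equal coefficient of `Z`, the shorter vector gives the smaller risk: for `‖v‖ ≤ ‖w‖`, in law
`c Z + √Z vᵀN` is a convex combination of `c Z + √Z wᵀN` and `c Z - √Z wᵀN`, which have the same
law. -/
lemma risk_mixture_le [IsProbabilityMeasure P] (hρ : IsConvexRiskMeasure P p ρ) (hlaw : IsLawInvariant P p ρ)
    (hp : 1 ≤ p) (hp' : p ≠ ⊤) (hZp : MemLp Z p P) (hN : HasLaw N (stdGaussian (Vec n)) P)
    (hZN : IndepFun Z N P) (c : ℝ) {v w : Vec n} (h : ‖v‖ ≤ ‖w‖) :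
    ρ (mixture Z N c v) ≤ ρ (mixture Z N c w) := by
  have hZ : AEMeasurable Z P := hZp.1.aemeasurable
  have hL := memLp_mixture hp hp' hZp hN hZN c
  have hlawN : ∀ {a b : Vec n}, ‖a‖ = ‖b‖ → ρ (mixture Z N c a) = ρ (mixture Z N c b) :=
    fun hab => hlaw _ _ (hL _) (hL _) (identDistrib_mixture_of_norm_eq hZ hN hZN c hab)
  set t : ℝ := ‖v‖ / ‖w‖ with ht
  have ht0 : 0 ≤ t := by positivity
  have ht1 : t ≤ 1 := div_le_one_of_le₀ h (norm_nonneg _)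
  have htw : ‖v‖ = ‖t • w‖ := by
    rw [norm_smul, Real.norm_of_nonneg ht0, ht, div_mul_cancel_of_imp]
    intro hw
    exact le_antisymm (hw ▸ h) (norm_nonneg _)
  have hcomb : mixture Z N c (t • w) = fun ω => (1 + t) / 2 * mixture Z N c w ω +
      (1 - (1 + t) / 2) * mixture Z N c (-w) ω := by
    funext ω
    simp only [mixture, inner_neg_left, real_inner_smul_left]
    ring
  rw [hlawN htw, hcomb]
  exact hρ.convexComb_le_of_eq (hL _) (hL _) (hlawN (norm_neg w).symm) (by linarith) (by linarith)

end Risk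

/-! ### The quadratic problem -/

section Quadratic

variable {n : ℕ} {m e : Vec n} {r : ℝ}

lemma mem_quadraticSolutions_iff {D : Set (Vec n)} {x : Vec n} :
    x ∈ quadraticSolutions D ↔ x ∈ D ∧ ∀ y ∈ D, ‖x‖ ≤ ‖y‖ := by
  simp only [quadraticSolutions, Set.mem_ofPred_eq, real_inner_self_eq_norm_sq]
  refine and_congr_right fun _ => forall₂_congr fun y _ => ?_
  exact sq_le_sq₀ (norm_nonneg _) (norm_nonneg _)

lemma quadraticSolutions_nonempty (h : (feasible m e r).Nonempty) :
    (quadraticSolutions (feasible m e r)).Nonempty := by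
  have hc : IsClosed (feasible m e r) :=
    (isClosed_eq (by fun_prop) (by fun_prop)).inter (isClosed_eq (by fun_prop) (by fun_prop))
  obtain ⟨q, hq, hd⟩ := hc.exists_infDist_eq_dist h 0
  refine ⟨q, mem_quadraticSolutions_iff.2 ⟨hq, fun y hy => ?_⟩⟩
  have := Metric.infDist_le_dist_of_mem (x := (0 : Vec n)) hy
  rw [hd] at this
  simpa using this

/-- The explicit point lies in the span of `m` and `e`, hence is orthogonal to all differences of
feasible points and is the orthogonal projection of `0` to the feasible set. -/
lemma quadraticSolutions_eq_singleton (hdet : gramDet m e ≠ 0) :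
    quadraticSolutions (feasible m e r) = {coeffS m e r • m + coeffT m e r • e} := by
  set x := coeffS m e r • m + coeffT m e r • e with hx
  have hS : coeffS m e r * gramDet m e = r * inner ℝ e e - inner ℝ e m := by
    rw [coeffS, div_mul_cancel₀ _ hdet, Matrix.det_fin_two_of]
    ring
  have hT : coeffT m e r * gramDet m e = inner ℝ m m - r * inner ℝ m e := by
    rw [coeffT, div_mul_cancel₀ _ hdet, Matrix.det_fin_two_of]
    ring
  have hG : gramDet m e = inner ℝ m m * inner ℝ e e - inner ℝ m e * inner ℝ m e := by
    rw [gramDet, Matrix.det_fin_two_of, real_inner_comm m e]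
  have hxD : x ∈ feasible m e r := by
    constructor
    · apply mul_right_cancel₀ hdet
      rw [hx, inner_add_left, real_inner_smul_left, real_inner_smul_left, real_inner_comm m e]
      rw [real_inner_comm m e] at hS
      linear_combination inner ℝ m m * hS + inner ℝ m e * hT - r * hG
    · apply mul_right_cancel₀ hdet
      rw [hx, inner_add_left, real_inner_smul_left, real_inner_smul_left]
      rw [real_inner_comm m e] at hS
      linear_combination inner ℝ m e * hS + inner ℝ e e * hT - hG
  have hpyth : ∀ y ∈ feasible m e r, ‖y‖ ^ 2 = ‖x‖ ^ 2 + ‖y - x‖ ^ 2 := by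
    intro y hy
    have h0 : inner ℝ x (y - x) = 0 := by
      have h1 : inner ℝ (y - x) m = 0 := by rw [inner_sub_left, hy.1, hxD.1, sub_self]
      have h2 : inner ℝ (y - x) e = 0 := by rw [inner_sub_left, hy.2, hxD.2, sub_self]
      rw [real_inner_comm]
      nth_rewrite 2 [hx]
      rw [inner_add_right, real_inner_smul_right, real_inner_smul_right, h1, h2]
      ring
    have := norm_add_sq_real x (y - x)
    rw [add_sub_cancel, h0] at this
    linarith
  ext y
  rw [mem_quadraticSolutions_iff, Set.mem_singleton_iff]
  constructor
  · rintro ⟨hy, hmin⟩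
    have h1 : ‖y‖ ^ 2 ≤ ‖x‖ ^ 2 := pow_le_pow_left₀ (norm_nonneg _) (hmin x hxD) 2
    have h2 : ‖y - x‖ ^ 2 = 0 := le_antisymm (by linarith [hpyth y hy]) (sq_nonneg _)
    simpa [sub_eq_zero] using h2
  · intro hyx
    rw [hyx]
    refine ⟨hxD, fun z hz => ?_⟩
    exact le_of_sq_le_sq (by linarith [hpyth z hz, sq_nonneg ‖z - x‖]) (norm_nonneg _)

end Quadratic


/-! ### Portfolios with prescribed positive mean -/

section Feasible

variable {Ω : Type*} [MeasurableSpace Ω] {P : Measure Ω} {n : ℕ} {Z : Ω → ℝ}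
  {A : Matrix (Fin n) (Fin n) ℝ} {γ e x : Vec n} {r : ℝ}

lemma mean_mul_inner_gamma0 (hx : x ∈ feasible (meanVec P Z A γ) e r) :
    (∫ ω, Z ω ∂P) * inner ℝ x (gamma0 A γ) = r := by
  rw [← hx.1, meanVec, real_inner_smul_right]

lemma integral_pos_of_feasible (hZ0 : ∀ᵐ ω ∂P, 0 ≤ Z ω) (hr : 0 < r)
    (hx : x ∈ feasible (meanVec P Z A γ) e r) : 0 < ∫ ω, Z ω ∂P := by
  refine lt_of_le_of_ne (integral_nonneg_of_ae hZ0) fun h => hr.ne ?_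
  rw [← mean_mul_inner_gamma0 hx, ← h, zero_mul]

lemma inner_gamma0_of_feasible (hZ0 : ∀ᵐ ω ∂P, 0 ≤ Z ω) (hr : 0 < r)
    (hx : x ∈ feasible (meanVec P Z A γ) e r) :
    inner ℝ x (gamma0 A γ) = r / ∫ ω, Z ω ∂P := by
  rw [eq_div_iff (integral_pos_of_feasible hZ0 hr hx).ne', mul_comm, mean_mul_inner_gamma0 hx]

lemma inner_gamma0_pos_of_feasible (hZ0 : ∀ᵐ ω ∂P, 0 ≤ Z ω) (hr : 0 < r)
    (hx : x ∈ feasible (meanVec P Z A γ) e r) : 0 < inner ℝ x (gamma0 A γ) := by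
  rw [inner_gamma0_of_feasible hZ0 hr hx]
  exact div_pos hr (integral_pos_of_feasible hZ0 hr hx)

lemma norm_pos_of_feasible (hZ0 : ∀ᵐ ω ∂P, 0 ≤ Z ω) (hr : 0 < r)
    (hx : x ∈ feasible (meanVec P Z A γ) e r) : 0 < ‖x‖ ∧ 0 < ‖gamma0 A γ‖ := by
  have h := inner_gamma0_pos_of_feasible hZ0 hr hx
  refine ⟨norm_pos_iff.2 fun h0 => ?_, norm_pos_iff.2 fun h0 => ?_⟩ <;> simp [h0] at h

/-- On the feasible set the cosine of the angle with `γ₀` is inversely proportional to the norm. -/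
lemma cos_angle_of_feasible (hZ0 : ∀ᵐ ω ∂P, 0 ≤ Z ω) (hr : 0 < r)
    (hx : x ∈ feasible (meanVec P Z A γ) e r) :
    Real.cos (InnerProductGeometry.angle x (gamma0 A γ)) =
      (r / ∫ ω, Z ω ∂P) / (‖x‖ * ‖gamma0 A γ‖) := by
  rw [InnerProductGeometry.cos_angle, inner_gamma0_of_feasible hZ0 hr hx]

lemma cos_angle_pos_of_feasible (hZ0 : ∀ᵐ ω ∂P, 0 ≤ Z ω) (hr : 0 < r)
    (hx : x ∈ feasible (meanVec P Z A γ) e r) :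
    0 < Real.cos (InnerProductGeometry.angle x (gamma0 A γ)) := by
  obtain ⟨h1, h2⟩ := norm_pos_of_feasible hZ0 hr hx
  rw [InnerProductGeometry.cos_angle]
  exact div_pos (inner_gamma0_pos_of_feasible hZ0 hr hx) (mul_pos h1 h2)

end Feasible

section Main

variable {Ω : Type*} [MeasurableSpace Ω] {P : Measure Ω} [IsProbabilityMeasure P]
  {n : ℕ} {Z : Ω → ℝ} {N : Ω → Vec n} {A : Matrix (Fin n) (Fin n) ℝ} {γ e x y : Vec n} {r : ℝ}

lemma risk_le_of_norm_le {p : ENNReal} (hp : 1 ≤ p) (hp' : p ≠ ⊤) {ρ : (Ω → ℝ) → EReal}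
    (hρ : IsConvexRiskMeasure P p ρ) (hlaw : IsLawInvariant P p ρ) (hZ0 : ∀ᵐ ω ∂P, 0 ≤ Z ω)
    (hZp : MemLp Z p P) (hN : HasLaw N (stdGaussian (Vec n)) P) (hZN : IndepFun Z N P)
    (hr : 0 < r) (hx : x ∈ feasible (meanVec P Z A γ) e r)
    (hy : y ∈ feasible (meanVec P Z A γ) e r) (h : ‖x‖ ≤ ‖y‖) :
    ρ (portfolio Z N A γ x) ≤ ρ (portfolio Z N A γ y) := by
  rw [portfolio_eq_mixture, portfolio_eq_mixture, inner_gamma0_of_feasible hZ0 hr hx,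
    inner_gamma0_of_feasible hZ0 hr hy]
  exact risk_mixture_le hρ hlaw hp hp' hZp hN hZN _ h

lemma skewness_le_of_norm_le (hZ0 : ∀ᵐ ω ∂P, 0 ≤ Z ω) (hZ : AEMeasurable Z P)
    (hN : HasLaw N (stdGaussian (Vec n)) P) (hZN : IndepFun Z N P) (hr : 0 < r)
    (hS : SkewDerivNonneg P Z ‖gamma0 A γ‖) (hx : x ∈ feasible (meanVec P Z A γ) e r)
    (hy : y ∈ feasible (meanVec P Z A γ) e r) (h : ‖x‖ ≤ ‖y‖) :
    skewness P (portfolio Z N A γ y) ≤ skewness P (portfolio Z N A γ x) := by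
  obtain ⟨hx0, hg⟩ := norm_pos_of_feasible hZ0 hr hx
  obtain ⟨hy0, -⟩ := norm_pos_of_feasible hZ0 hr hy
  have hμ := integral_pos_of_feasible hZ0 hr hx
  rw [skewness_portfolio hZ hN hZN A γ (norm_pos_iff.1 hx0),
    skewness_portfolio hZ hN hZN A γ (norm_pos_iff.1 hy0)]
  refine hS.monotoneOn ⟨Real.neg_one_le_cos _, Real.cos_le_one _⟩
    ⟨Real.neg_one_le_cos _, Real.cos_le_one _⟩ ?_
  rw [cos_angle_of_feasible hZ0 hr hx, cos_angle_of_feasible hZ0 hr hy]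
  gcongr

lemma skewness_lt_of_norm_lt (hZ0 : ∀ᵐ ω ∂P, 0 ≤ Z ω) (hZ3 : MemLp Z 3 P)
    (hN : HasLaw N (stdGaussian (Vec n)) P) (hZN : IndepFun Z N P) (hr : 0 < r)
    (hV : Var[Z; P] ≠ 0) (hS : SkewDerivNonneg P Z ‖gamma0 A γ‖)
    (hx : x ∈ feasible (meanVec P Z A γ) e r)
    (hy : y ∈ feasible (meanVec P Z A γ) e r) (h : ‖x‖ < ‖y‖) :
    skewness P (portfolio Z N A γ y) < skewness P (portfolio Z N A γ x) := by
  obtain ⟨hx0, hg⟩ := norm_pos_of_feasible hZ0 hr hx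
  obtain ⟨hy0, -⟩ := norm_pos_of_feasible hZ0 hr hy
  have hμ := integral_pos_of_feasible hZ0 hr hx
  have hZ : AEMeasurable Z P := hZ3.1.aemeasurable
  rw [skewness_portfolio hZ hN hZN A γ (norm_pos_iff.1 hx0),
    skewness_portfolio hZ hN hZN A γ (norm_pos_iff.1 hy0)]
  refine hS.strictMonoOn hZ0 hZ3 hμ hV hg
    ⟨(cos_angle_pos_of_feasible hZ0 hr hy).le, Real.cos_le_one _⟩
    ⟨(cos_angle_pos_of_feasible hZ0 hr hx).le, Real.cos_le_one _⟩ ?_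
  rw [cos_angle_of_feasible hZ0 hr hx, cos_angle_of_feasible hZ0 hr hy]
  gcongr

end Main

end MeanRiskSkew

/-! ### The equivalence of the two problems -/

theorem theorem2p5 {Ω : Type*} [MeasurableSpace Ω] (P : Measure Ω) [IsProbabilityMeasure P]
    -- the risk measure
    (p : ENNReal) (hp : 1 ≤ p) (hp' : p ≠ ⊤) (ρ : (Ω → ℝ) → EReal)
    (hρ : IsCoherentRiskMeasure P p ρ) (hlaw : IsLawInvariant P p ρ)
    -- the mixing variable and the independent standard normal vector
    (n : ℕ) (Z : Ω → ℝ) (N : Ω → EuclideanSpace ℝ (Fin n))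
    (hZ0 : ∀ᵐ ω ∂P, 0 ≤ Z ω) (hZp : MemLp Z p P) (hZ3 : MemLp Z 3 P)
    (hN : HasLaw N (stdGaussian (EuclideanSpace ℝ (Fin n))) P) (hZN : IndepFun Z N P)
    -- the parameters and the required return
    (A : Matrix (Fin n) (Fin n) ℝ) (hA : IsUnit A.det) (γ : EuclideanSpace ℝ (Fin n))
    (r : ℝ) (hr : 0 < r) :
    let m := meanVec P Z A γ
    let e := eA A
    let D := feasible m e r
    let risk : EuclideanSpace ℝ (Fin n) → EReal := fun x => ρ (portfolio Z N A γ x)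
    let skew : EuclideanSpace ℝ (Fin n) → ℝ := fun x => skewness P (portfolio Z N A γ x)
    -- the skewness is a function of the cosine of the angle
    (∀ x, x ≠ 0 → skew x =
      skewOfCos P Z ‖gamma0 A γ‖ (Real.cos (InnerProductGeometry.angle x (gamma0 A γ)))) ∧
    -- the sufficient condition
    (2 * Var[Z; P] ^ 2 ≤ centralMoment Z 3 P * (∫ ω, Z ω ∂P) →
      SkewDerivNonneg P Z ‖gamma0 A γ‖) ∧
    -- the reduction to the quadratic problem, and its explicit solution
    (SkewDerivNonneg P Z ‖gamma0 A γ‖ →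
      quadraticSolutions D ⊆ riskSkewSolutions risk skew D ∧
      (Var[Z; P] ≠ 0 → riskSkewSolutions risk skew D = quadraticSolutions D) ∧
      (gramDet m e ≠ 0 →
        quadraticSolutions D = {coeffS m e r • m + coeffT m e r • e})) := by
  intro m e D risk skew
  have hZ : AEMeasurable Z P := hZ3.1.aemeasurable
  refine ⟨fun x hx => skewness_portfolio hZ hN hZN A γ hx,
    skewDerivNonneg_of_le hZ0 hZ3 (norm_nonneg _), fun hS => ?_⟩
  have hsub : quadraticSolutions D ⊆ riskSkewSolutions risk skew D := by
    intro x hx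
    obtain ⟨hxD, hmin⟩ := mem_quadraticSolutions_iff.1 hx
    exact ⟨hxD,
      fun y hy => risk_le_of_norm_le hp hp' hρ.toIsConvexRiskMeasure hlaw hZ0 hZp hN hZN hr hxD hy
        (hmin y hy),
      fun y hy => skewness_le_of_norm_le hZ0 hZ hN hZN hr hS hxD hy (hmin y hy)⟩
  refine ⟨hsub, fun hV => Set.Subset.antisymm (fun x hx => ?_) hsub,
    quadraticSolutions_eq_singleton⟩
  obtain ⟨hxD, -, hmax⟩ := hx
  -- a point of maximal skewness cannot be longer than a point of minimal norm
  obtain ⟨q, hq⟩ := quadraticSolutions_nonempty ⟨x, hxD⟩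
  obtain ⟨hqD, hqmin⟩ := mem_quadraticSolutions_iff.1 hq
  have hxq : ‖x‖ ≤ ‖q‖ := by
    by_contra! hlt
    exact (skewness_lt_of_norm_lt hZ0 hZ3 hN hZN hr hV hS hqD hxD hlt).not_ge (hmax q hqD)
  exact mem_quadraticSolutions_iff.2 ⟨hxD, fun y hy => hxq.trans (hqmin y hy)⟩
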